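/- **Theorem 3.** Let $p\ge 1$, let $X_1,\dots,X_p$ be discrete variables with finite sample spaces $\mathcal X_1,\dots,\mathcal X_p$, each with at least two elements, and let $G$ be an undirected graph with nodes $1,\dots,p$, where $\mathrm{adj}(i)$ denotes the set of nodes adjacent to $i$. An *acyclic probabilistic finite automaton* (APFA) for these variables is a finite directed multigraph with symbol-labelled edges, with exactly one state without incoming edges (the root) and exactly one state without outgoing edges (the sink), these being distinct, such that every state lies on a path from the root to the sink, distinct edges leaving the same state carry distinct symbols, every path from the root to the sink has length $p$, and $\mathcal X_k$ is the set of the symbols of the $k$-th edges of these paths. The APFA model consists of all distributions on $\prod_i\mathcal X_i$ obtained by choosing nonnegative edge probabilities that sum to one over the edges leaving each state other than the sink, and giving $x=(x_1,\dots,x_p)$ the product of the edge probabilities along the root-to-sink path with symbol sequence $x$ (and probability $0$ if there is no such path). The undirected graphical model of $G$ consists of all probability distributions on $\prod_i\mathcal X_i$ such that $X_B$ and $X_C$ are conditionally independent given $X_A$ whenever $A,B,C$ are disjoint sets of nodes and $A$ separates $B$ from $C$ in $G$. Two models are equivalent if they consist of the same distributions. Then the undirected graphical model of $G$ is equivalent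 to some APFA model if and only if $$\mathrm{adj}(i)\cap\{1,\dots,i-1\}\subseteq\bigl(\mathrm{adj}(i-1)\cap\{1,\dots,i-2\}\bigr)\cup\{i-1\}\qquad\text{for } i=2,\dots,p.$$ -/

import Mathlib

open Finset

universe u

/-- The underlying labelled multigraph of a probabilistic finite automaton over the alphabet `Sym`:
finitely many states and edges, source, target and symbol maps, a root and a sink.
The edge probabilities are not part of the graph: they are the parameters of the model. -/
structure PFA (Sym : Type u) where
  V : Type
  E : Type
  [fintypeV : Fintype V]
  [fintypeE : Fintype E]
  src : E → V
  tgt : E → V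
  sym : E → Sym
  root : V
  sink : V
  root_ne_sink : root ≠ sink
  /-- the root has only outgoing edges -/
  tgt_ne_root : ∀ e, tgt e ≠ root
  /-- the sink has only incoming edges -/
  src_ne_sink : ∀ e, src e ≠ sink
  exists_incoming : ∀ v, v ≠ root → ∃ e, tgt e = v
  exists_outgoing : ∀ v, v ≠ sink → ∃ e, src e = v
  /-- outgoing edges of a state carry distinct symbols -/
  sym_injective : ∀ e f, src e = src f → sym e = sym f → e = f

namespace PFA

attribute [instance] PFA.fintypeV PFA.fintypeE

variable {Sym : Type u}

/-- The list of edges `l` is a directed path from `v` to `w`. -/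
def IsPath (A : PFA Sym) : A.V → List A.E → A.V → Prop
  | v, [], w => v = w
  | v, e :: l, w => A.src e = v ∧ A.IsPath (A.tgt e) l w

/-- The sequence of edges `e` is a root-to-sink path (of length `p`). -/
def IsRootSinkPath (A : PFA Sym) {p : ℕ} (e : Fin p → A.E) : Prop :=
  A.IsPath A.root (List.ofFn e) A.sink

open Classical in
/-- The parameter space: nonnegative edge probabilities such that the probabilities of the outgoing
edges of every state with outgoing edges (every state but the sink) sum to one. -/
def paramSpace (A : PFA Sym) : Set (A.E → ℝ) :=
  {π | (∀ e, 0 ≤ π e) ∧ ∀ v, v ≠ A.sink → ∑ e with A.src e = v, π e = 1}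

end PFA

/-- An acyclic probabilistic finite automaton for `p` discrete variables with sample spaces
`𝒳 0, …, 𝒳 (p - 1)`, subsets of the alphabet: a PFA all of whose states lie on root-to-sink paths,
all of whose root-to-sink paths have length `p`, and in which `𝒳 k` is the set of the symbols in
position `k` on root-to-sink paths. -/
structure APFA {Sym : Type u} {p : ℕ} (𝒳 : Fin p → Finset Sym) extends PFA Sym where
  path_from_root : ∀ v, ∃ l, toPFA.IsPath root l v
  path_to_sink : ∀ v, ∃ l, toPFA.IsPath v l sink
  length_eq : ∀ l, toPFA.IsPath root l sink → l.length = p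
  mem_sampleSpace : ∀ (k : Fin p) (a : Sym),
    a ∈ 𝒳 k ↔ ∃ e : Fin p → E, toPFA.IsRootSinkPath e ∧ sym (e k) = a

section Models

variable {Sym : Type u} {p : ℕ} {𝒳 : Fin p → Finset Sym}

open Classical in
/-- The probability that the automaton with edge probabilities `π` generates the string `x`: the
product of the edge probabilities along the root-to-sink path whose symbol sequence is `x`
(there is at most one; the probability is zero if there is none). -/
noncomputable def APFA.prob (A : APFA 𝒳) (π : A.E → ℝ) (x : (i : Fin p) → 𝒳 i) : ℝ :=
  ∑ e : Fin p → A.E with A.IsRootSinkPath e ∧ ∀ k, A.sym (e k) = (x k : Sym), ∏ k, π (e k)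

/-- The APFA model: all distributions of `(X_1, …, X_p)` that the automaton generates. -/
def APFA.model (A : APFA 𝒳) : Set (((i : Fin p) → 𝒳 i) → ℝ) :=
  {P | ∃ π ∈ A.paramSpace, P = A.prob π}

open Classical in
/-- `marginal P S x` is `Pr(X_S = x_S)` when `X` has density `P`. -/
noncomputable def marginal (P : ((i : Fin p) → 𝒳 i) → ℝ) (S : Finset (Fin p))
    (x : (i : Fin p) → 𝒳 i) : ℝ :=
  ∑ y : (i : Fin p) → 𝒳 i with ∀ i ∈ S, y i = x i, P y

open Classical in
/-- Conditional independence of `X_B` and `X_C` given `X_A` when `X` has density `P`. -/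
def CondIndependent (P : ((i : Fin p) → 𝒳 i) → ℝ) (B C A : Finset (Fin p)) : Prop :=
  ∀ x, marginal P (A ∪ B ∪ C) x * marginal P A x = marginal P (A ∪ B) x * marginal P (A ∪ C) x

/-- `A` separates `B` from `C` in `G`: every walk from `B` to `C` meets `A`. -/
def Separates (G : SimpleGraph (Fin p)) (A B C : Finset (Fin p)) : Prop :=
  ∀ b ∈ B, ∀ c ∈ C, ∀ w : G.Walk b c, ∃ a ∈ A, a ∈ w.support

/-- The undirected graphical model of `G` for variables with sample spaces `𝒳`: all probability
densities on `∏ 𝒳 i` that satisfy the global Markov property with respect to `G`. -/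
def graphicalModel (𝒳 : Fin p → Finset Sym) (G : SimpleGraph (Fin p)) :
    Set (((i : Fin p) → 𝒳 i) → ℝ) :=
  {P | P ∈ stdSimplex ℝ ((i : Fin p) → 𝒳 i) ∧
    ∀ A B C : Finset (Fin p), Disjoint A B → Disjoint A C → Disjoint B C →
      Separates G A B C → CondIndependent P B C A}

end Models

/-! The condition on consecutive nodes propagates to all nodes in between (`IsMemory.adj_of_adj`):
if h < j < i and i is adjacent to h, then so is j. Both directions pass through this form.

Sufficiency: under this form, each node k makes a clique with its earlier neighbours, and these
separate k from the rest of its past. By the chain rule one way and factorization over cliques the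
other, the graphical model consists of the products of kernels for X_k given its earlier neighbours
(`graphicalModel_eq_sequentialModel`). An automaton can generate X_k from a state that stores just
those values, because what is stored at k is either stored at k - 1 or generated there. Its edge
probabilities are exactly such kernels (`memoryAPFA_model`).

Necessity (`APFA.adj_of_model_eq`): if i is adjacent to h, some positive density in the model has
X_i and X_h dependent, so at an intermediate level j the states must remember a fact about X_h
(`APFA.prob_mul_prob_eq`). Edge probabilities are free, so the states with that memory can be made
to emit a fixed symbol. Then X_h constrains the support of X_j, which is impossible when j and h are
not adjacent (`pos_of_mem_graphicalModel`). -/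

section Markov

variable {Sym : Type u} {p : ℕ} {𝒳 : Fin p → Finset Sym}

/-! ### Marginals of a density -/

lemma marginal_congr (P : ((i : Fin p) → 𝒳 i) → ℝ) {S : Finset (Fin p)} {x y : (i : Fin p) → 𝒳 i}
    (h : ∀ i ∈ S, x i = y i) : marginal P S x = marginal P S y := by
  classical
  unfold marginal
  refine Finset.sum_congr (Finset.filter_congr fun z _ => ?_) fun _ _ => rfl
  exact forall₂_congr fun i hi => by rw [h i hi]

lemma marginal_nonneg {P : ((i : Fin p) → 𝒳 i) → ℝ} (hP : ∀ x, 0 ≤ P x) (S : Finset (Fin p))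
    (x : (i : Fin p) → 𝒳 i) : 0 ≤ marginal P S x :=
  Finset.sum_nonneg fun y _ => hP y

lemma marginal_anti {P : ((i : Fin p) → 𝒳 i) → ℝ} (hP : ∀ x, 0 ≤ P x) {S T : Finset (Fin p)}
    (h : S ⊆ T) (x : (i : Fin p) → 𝒳 i) : marginal P T x ≤ marginal P S x := by
  classical
  unfold marginal
  refine Finset.sum_le_sum_of_subset_of_nonneg (fun y hy => ?_) fun y _ _ => hP y
  simp only [Finset.mem_filter, Finset.mem_univ, true_and] at hy ⊢
  exact fun i hi => hy i (h hi)

lemma marginal_univ (P : ((i : Fin p) → 𝒳 i) → ℝ) (x : (i : Fin p) → 𝒳 i) :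
    marginal P univ x = P x := by
  classical
  unfold marginal
  rw [Finset.sum_eq_single x]
  · intro y hy hyx
    exact absurd (funext fun i => (Finset.mem_filter.1 hy).2 i (Finset.mem_univ i)) hyx
  · simp

lemma marginal_empty (P : ((i : Fin p) → 𝒳 i) → ℝ) (x : (i : Fin p) → 𝒳 i) :
    marginal P ∅ x = ∑ y, P y := by
  classical
  simp [marginal]

lemma le_marginal {P : ((i : Fin p) → 𝒳 i) → ℝ} (hP : ∀ x, 0 ≤ P x) {S : Finset (Fin p)}
    {x y : (i : Fin p) → 𝒳 i} (h : ∀ i ∈ S, y i = x i) : P y ≤ marginal P S x := by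
  classical
  unfold marginal
  exact Finset.single_le_sum (f := P) (fun z _ => hP z) (by simpa using h)

lemma sum_marginal_insert_update (P : ((i : Fin p) → 𝒳 i) → ℝ) {S : Finset (Fin p)} {k : Fin p}
    (hk : k ∉ S) (x : (i : Fin p) → 𝒳 i) :
    ∑ a, marginal P (insert k S) (Function.update x k a) = marginal P S x := by
  classical
  unfold marginal
  rw [← Finset.sum_fiberwise (s := Finset.univ.filter fun y : (i : Fin p) → 𝒳 i => ∀ i ∈ S, y i = x i)
    (g := fun y => y k)]
  refine Finset.sum_congr rfl fun a _ => ?_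
  rw [Finset.filter_filter]
  refine Finset.sum_congr (Finset.filter_congr fun y _ => ?_) fun _ _ => rfl
  rw [Finset.forall_mem_insert, Function.update_self, and_comm]
  refine and_congr (forall₂_congr fun i hi => ?_) Iff.rfl
  rw [Function.update_of_ne]
  rintro rfl
  exact hk hi

/-! ### Factorization over cliques and the Markov property -/

/-- A density that splits into a factor on `S` and a factor on `T` makes the coordinates in `S`
and those outside `S` independent given `S ∩ T`. -/
lemma condIndependent_of_mul {F H : ((i : Fin p) → 𝒳 i) → ℝ} {S T : Set (Fin p)}
    (hF : DependsOn F S) (hH : DependsOn H T) {A B C : Finset (Fin p)}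
    (hST : ∀ i ∈ S, i ∈ T → i ∈ A) (hB : ∀ i ∈ B, i ∈ S) (hC : ∀ i ∈ C, i ∉ S) :
    CondIndependent (fun x => F x * H x) B C A := by
  classical
  intro x
  unfold marginal
  rw [Finset.sum_mul_sum, Finset.sum_mul_sum, ← Finset.sum_product', ← Finset.sum_product']
  -- Exchanging the coordinates outside `S` is an involution on pairs. It keeps both values of `F`
  -- and interchanges those of `H`, because the two configurations agree on `A`, hence on `S ∩ T`.
  -- So the double sums match term by term.
  let swap : (((i : Fin p) → 𝒳 i) × ((i : Fin p) → 𝒳 i)) → ((i : Fin p) → 𝒳 i) × ((i : Fin p) → 𝒳 i) :=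
    fun q => (fun i => if i ∈ S then q.1 i else q.2 i, fun i => if i ∈ S then q.2 i else q.1 i)
  have hswap : ∀ q, swap (swap q) = q := by
    intro q
    ext i <;> by_cases hi : i ∈ S <;> simp [swap, hi]
  refine Finset.sum_nbij' swap swap ?_ ?_ (fun q _ => hswap q) (fun q _ => hswap q) ?_
  · rintro ⟨y, z⟩ hq
    simp only [mem_product, mem_filter, mem_univ, true_and, mem_union] at hq ⊢
    obtain ⟨hy, hz⟩ := hq
    refine ⟨fun i hi => ?_, fun i hi => ?_⟩
    · by_cases hS : i ∈ S
      · simpa [swap, hS] using hy i (Or.inl hi)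
      · simpa [swap, hS] using hz i (hi.resolve_right fun h => hS (hB i h))
    · by_cases hS : i ∈ S
      · simpa [swap, hS] using hz i (hi.resolve_right fun h => hC i h hS)
      · simpa [swap, hS] using hy i (hi.imp_left Or.inl)
  · rintro ⟨y, z⟩ hq
    simp only [mem_product, mem_filter, mem_univ, true_and, mem_union] at hq ⊢
    obtain ⟨hy, hz⟩ := hq
    refine ⟨fun i hi => ?_, fun i hi => ?_⟩
    · by_cases hS : i ∈ S
      · simpa [swap, hS] using hy i (hi.resolve_right fun h => hC i h hS)
      · simpa [swap, hS] using hz i ((or_assoc.1 hi).imp_right fun h =>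
          h.resolve_left fun h => hS (hB i h))
    · by_cases hS : i ∈ S
      · simpa [swap, hS] using hz i (Or.inl hi)
      · simpa [swap, hS] using hy i (Or.inl hi)
  · rintro ⟨y, z⟩ hq
    simp only [mem_product, mem_filter, mem_univ, true_and, mem_union] at hq
    obtain ⟨hy, hz⟩ := hq
    have h1 : F (swap (y, z)).1 = F y := hF fun i hi => by simp [swap, hi]
    have h2 : F (swap (y, z)).2 = F z := hF fun i hi => by simp [swap, hi]
    have h3 : H (swap (y, z)).1 = H z := hH fun i hi => by
      by_cases hS : i ∈ S
      · simp [swap, hS, hy i (Or.inl (Or.inl (hST i hS hi))), hz i (hST i hS hi)]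
      · simp [swap, hS]
    have h4 : H (swap (y, z)).2 = H y := hH fun i hi => by
      by_cases hS : i ∈ S
      · simp [swap, hS, hy i (Or.inl (Or.inl (hST i hS hi))), hz i (hST i hS hi)]
      · simp [swap, hS]
    simp only [h1, h2, h3, h4]
    ring

lemma dependsOn_prod {ι : Type*} (s : Finset ι) {φ : ι → ((i : Fin p) → 𝒳 i) → ℝ} {S : Set (Fin p)}
    (h : ∀ k ∈ s, DependsOn (φ k) S) : DependsOn (fun x => ∏ k ∈ s, φ k x) S :=
  fun _ _ hxy => Finset.prod_congr rfl fun k hk => h k hk hxy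

/-- A density that factorizes over cliques satisfies the global Markov property. -/
lemma condIndependent_of_prod {G : SimpleGraph (Fin p)} {ι : Type*} [Fintype ι]
    {φ : ι → ((i : Fin p) → 𝒳 i) → ℝ} {c : ι → Set (Fin p)} (hφ : ∀ k, DependsOn (φ k) (c k))
    (hc : ∀ k, G.IsClique (c k)) {A B C : Finset (Fin p)} (hAB : Disjoint A B) (hAC : Disjoint A C)
    (h : Separates G A B C) : CondIndependent (fun x => ∏ k, φ k x) B C A := by
  classical
  -- The nodes reachable from `B` while avoiding `A`. A clique that meets `U` stays inside `U ∪ A`,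
  -- which is disjoint from `C` by separation; this splits the product in two.
  let U : Set (Fin p) := {v | ∃ b ∈ B, ∃ w : G.Walk b v, ∀ a ∈ A, a ∉ w.support}
  have hsplit : (fun x => ∏ k, φ k x) = fun x => (∏ k with (c k ∩ U).Nonempty, φ k x) *
      ∏ k with ¬ (c k ∩ U).Nonempty, φ k x :=
    funext fun x => (Finset.prod_filter_mul_prod_filter_not _ _ _).symm
  rw [hsplit]
  refine condIndependent_of_mul (S := U ∪ A) (T := Uᶜ) ?_ ?_ ?_ ?_ ?_
  · refine dependsOn_prod _ fun k hk => ?_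
    obtain ⟨v, hv, b, hb, w, hw⟩ := (Finset.mem_filter.1 hk).2
    refine fun x y hxy => hφ k fun i hi => hxy i ?_
    by_cases hiA : i ∈ A
    · exact Or.inr hiA
    by_cases hvi : v = i
    · subst hvi
      exact Or.inl ⟨b, hb, w, hw⟩
    refine Or.inl ⟨b, hb, w.concat (hc k hv hi hvi), fun a ha => ?_⟩
    rw [SimpleGraph.Walk.support_concat, List.mem_append, List.mem_singleton]
    rintro (h | rfl)
    · exact hw a ha h
    · exact hiA ha
  · refine dependsOn_prod _ fun k hk => ?_
    have hk' := (Finset.mem_filter.1 hk).2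
    exact fun x y hxy => hφ k fun i hi => hxy i fun hiU => hk' ⟨i, hi, hiU⟩
  · rintro i (hi | hi) hT
    · exact absurd hi hT
    · exact hi
  · intro b hb
    refine Or.inl ⟨b, hb, .nil, fun a ha => ?_⟩
    rw [SimpleGraph.Walk.support_nil, List.mem_singleton]
    rintro rfl
    exact Finset.disjoint_left.1 hAB ha hb
  · rintro i hi (⟨b, hb, w, hw⟩ | hA)
    · obtain ⟨a, ha, haw⟩ := h b hb i hi w
      exact hw a ha haw
    · exact Finset.disjoint_left.1 hAC hA hi

/-! ### Sequentially generated densities -/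

/-- The involution on pairs that exchanges `a` with the `k`-th coordinate of `x` matches the sums.
It serves to sum out one coordinate without splitting the product space. -/
lemma sum_sum_update (f : ((i : Fin p) → 𝒳 i) → ℝ) (k : Fin p) :
    ∑ x, ∑ a, f (Function.update x k a) = (𝒳 k).card * ∑ x, f x := by
  classical
  have h : ∀ x : (i : Fin p) → 𝒳 i,
      ∑ a, f (Function.update x k a) = marginal f (univ.erase k) x := by
    intro x
    rw [← sum_marginal_insert_update f (Finset.notMem_erase k univ) x]
    simp [marginal_univ]
  have h2 : ∀ x : (i : Fin p) → 𝒳 i, ∑ a : 𝒳 k, f x = (𝒳 k).card * f x := by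
    intro x
    simp
  rw [Finset.mul_sum]
  simp_rw [← h2]
  rw [← Finset.sum_product', ← Finset.sum_product', Finset.univ_product_univ]
  refine Finset.sum_nbij' (fun q => (Function.update q.1 k q.2, q.1 k))
    (fun q => (Function.update q.1 k q.2, q.1 k)) ?_ ?_ ?_ ?_ ?_ <;> simp

/-- Sequentially generated weights form a probability distribution. -/
lemma sum_prod_eq_one (h𝒳 : ∀ i, (𝒳 i).Nonempty) {κ : Fin p → ((i : Fin p) → 𝒳 i) → ℝ}
    (hκ : ∀ k, DependsOn (κ k) (Set.Iic k))
    (hsum : ∀ k x, ∑ a, κ k (Function.update x k a) = 1) : ∑ x, ∏ k, κ k x = 1 := by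
  classical
  have hc : ∀ k, ((𝒳 k).card : ℝ) ≠ 0 := fun k => by
    exact_mod_cast (Finset.card_pos.2 (h𝒳 k)).ne'
  -- Interpolation from the uniform distribution (`n = 0`) to the product of the kernels (`n = p`).
  -- Raising `n` by one changes only the factor of coordinate `n`, which no other factor sees:
  -- earlier kernels do not depend on it and later factors are constant.
  have key : ∀ n : ℕ, n ≤ p →
      ∑ x, ∏ k : Fin p, (if (k : ℕ) < n then κ k x else ((𝒳 k).card : ℝ)⁻¹) = 1 := by
    intro n
    induction n with
    | zero =>
      intro _
      simp only [Nat.not_lt_zero, if_false, Finset.sum_const, Finset.card_univ, Fintype.card_pi,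
        Fintype.card_coe, nsmul_eq_mul, Nat.cast_prod]
      rw [← Finset.prod_mul_distrib]
      exact Finset.prod_eq_one fun k _ => mul_inv_cancel₀ (hc k)
    | succ n ih =>
      intro hn
      rw [← ih (by omega)]
      let m : Fin p := ⟨n, hn⟩
      refine mul_left_cancel₀ (hc m) ?_
      rw [← sum_sum_update, ← sum_sum_update]
      refine Finset.sum_congr rfl fun x _ => ?_
      have hrest : ∀ a : 𝒳 m, ∏ k ∈ univ.erase m,
          (if (k : ℕ) < n + 1 then κ k (Function.update x m a) else ((𝒳 k).card : ℝ)⁻¹) =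
          ∏ k ∈ univ.erase m, (if (k : ℕ) < n then κ k x else ((𝒳 k).card : ℝ)⁻¹) := by
        intro a
        refine Finset.prod_congr rfl fun k hk => ?_
        have hkm : (k : ℕ) ≠ n := fun h => (Finset.mem_erase.1 hk).1 (Fin.ext h)
        by_cases hkn : (k : ℕ) < n
        · rw [if_pos hkn, if_pos (by omega)]
          refine hκ k fun i hi => Function.update_of_ne ?_ _ _
          rintro rfl
          exact absurd (Fin.le_def.1 hi) (by simp [m]; omega)
        · rw [if_neg hkn, if_neg (by omega)]
      have hrest' : ∀ a : 𝒳 m, ∏ k ∈ univ.erase m,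
          (if (k : ℕ) < n then κ k (Function.update x m a) else ((𝒳 k).card : ℝ)⁻¹) =
          ∏ k ∈ univ.erase m, (if (k : ℕ) < n then κ k x else ((𝒳 k).card : ℝ)⁻¹) := by
        intro a
        rw [← hrest a]
        refine Finset.prod_congr rfl fun k hk => ?_
        have hkm : (k : ℕ) ≠ n := fun h => (Finset.mem_erase.1 hk).1 (Fin.ext h)
        have : (k : ℕ) < n ↔ (k : ℕ) < n + 1 := by omega
        simp only [this]
      have hl : ∀ a : 𝒳 m, ∏ k : Fin p,
          (if (k : ℕ) < n + 1 then κ k (Function.update x m a) else ((𝒳 k).card : ℝ)⁻¹) =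
          κ m (Function.update x m a) * ∏ k ∈ univ.erase m,
            (if (k : ℕ) < n then κ k x else ((𝒳 k).card : ℝ)⁻¹) := by
        intro a
        rw [← Finset.mul_prod_erase _ _ (Finset.mem_univ m), hrest]
        simp [m]
      have hr : ∀ a : 𝒳 m, ∏ k : Fin p,
          (if (k : ℕ) < n then κ k (Function.update x m a) else ((𝒳 k).card : ℝ)⁻¹) =
          ((𝒳 m).card : ℝ)⁻¹ * ∏ k ∈ univ.erase m,
            (if (k : ℕ) < n then κ k x else ((𝒳 k).card : ℝ)⁻¹) := by
        intro a
        rw [← Finset.mul_prod_erase _ _ (Finset.mem_univ m), hrest']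
        simp [m]
      simp_rw [hl, hr]
      rw [← Finset.sum_mul, hsum, Finset.sum_const, Finset.card_univ, Fintype.card_coe,
        nsmul_eq_mul, ← mul_assoc, mul_inv_cancel₀ (hc m)]
  simpa using key p le_rfl

/-- The neighbours of `k` that precede `k`. -/
def earlierNeighbors (G : SimpleGraph (Fin p)) (k : Fin p) : Set (Fin p) :=
  {i | G.Adj k i ∧ i < k}

/-- The densities generated sequentially, where the distribution of `X_k` given its past depends
on `X_i`, `i ∈ D k`, only. -/
def sequentialModel (𝒳 : Fin p → Finset Sym) (D : Fin p → Set (Fin p)) :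
    Set (((i : Fin p) → 𝒳 i) → ℝ) :=
  {P | ∃ κ : Fin p → ((i : Fin p) → 𝒳 i) → ℝ, (∀ k, DependsOn (κ k) (insert k (D k))) ∧
    (∀ k x, 0 ≤ κ k x) ∧ (∀ k x, ∑ a, κ k (Function.update x k a) = 1) ∧
    P = fun x => ∏ k, κ k x}

/-- By `hG`, two earlier neighbours of a node are adjacent, so every kernel lives on a clique. -/
lemma sequentialModel_subset_graphicalModel (h𝒳 : ∀ i, (𝒳 i).Nonempty) {G : SimpleGraph (Fin p)}
    (hG : ∀ h j i : Fin p, h < j → j < i → G.Adj i h → G.Adj j h) :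
    sequentialModel 𝒳 (earlierNeighbors G) ⊆ graphicalModel 𝒳 G := by
  rintro _ ⟨κ, hdep, hnonneg, hsum, rfl⟩
  have hle : ∀ k, insert k (earlierNeighbors G k) ⊆ Set.Iic k := by
    rintro k i (rfl | hi)
    · exact Set.mem_Iic.2 le_rfl
    · exact Set.mem_Iic.2 hi.2.le
  refine ⟨⟨fun x => Finset.prod_nonneg fun k _ => hnonneg k x,
    sum_prod_eq_one h𝒳 (fun k x y hxy => hdep k fun i hi => hxy i (hle k hi)) hsum⟩, ?_⟩
  intro A B C hAB hAC _ hsep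
  refine condIndependent_of_prod hdep (fun k => ?_) hAB hAC hsep
  have hlt : ∀ i ∈ earlierNeighbors G k, ∀ j ∈ earlierNeighbors G k, i < j → G.Adj j i :=
    fun i hi j hj hij => hG i j k hij hj.2 hi.1
  rintro i (rfl | hi) j (rfl | hj) hij
  · exact absurd rfl hij
  · exact hj.1
  · exact hi.1.symm
  · rcases lt_or_gt_of_ne hij with h | h
    · exact (hlt i hi j hj h).symm
    · exact hlt j hj i hi h

/-- Used to separate `k` from its past: a walk from `k` to an earlier node has an edge stepping
below `k`, and under the hypothesis `hG` of the next lemma the lower end of that edge is an earlier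
neighbour of `k`. -/
lemma exists_crossing {G : SimpleGraph (Fin p)} {k u v : Fin p} (w : G.Walk u v) (hu : k ≤ u)
    (hv : v < k) : ∃ m h, k ≤ m ∧ h < k ∧ G.Adj m h ∧ h ∈ w.support := by
  induction w with
  | nil => exact absurd hv (not_lt.2 hu)
  | @cons a b c hab w ih =>
    by_cases hb : k ≤ b
    · obtain ⟨m, h, hm, hh, hadj, hmem⟩ := ih hb hv
      exact ⟨m, h, hm, hh, hadj, by simp [hmem]⟩
    · exact ⟨a, b, hu, not_le.1 hb, hab, by simp⟩

/-- This is the chain rule, with conditioning on the whole past reduced to the earlier neighbours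
because they separate `k` from the other earlier nodes. -/
lemma graphicalModel_subset_sequentialModel (h𝒳 : ∀ i, (𝒳 i).Nonempty) {G : SimpleGraph (Fin p)}
    (hG : ∀ h j i : Fin p, h < j → j < i → G.Adj i h → G.Adj j h) :
    graphicalModel 𝒳 G ⊆ sequentialModel 𝒳 (earlierNeighbors G) := by
  classical
  rintro P ⟨⟨hP0, hP1⟩, hM⟩
  let D : Fin p → Finset (Fin p) := fun k => univ.filter fun i => i ∈ earlierNeighbors G k
  have hD : ∀ k i, i ∈ D k ↔ i ∈ earlierNeighbors G k := fun k i => by simp [D]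
  have hkD : ∀ k, k ∉ D k := fun k hk => lt_irrefl k ((hD k k).1 hk).2
  have hdep : ∀ (S : Finset (Fin p)), DependsOn (marginal P S) (S : Set (Fin p)) :=
    fun S x y hxy => marginal_congr P hxy
  -- The uniform value on conditioning events of probability zero keeps the kernel normalized. It
  -- has no effect on the product identity, since the whole past then has probability zero too.
  let κ : Fin p → ((i : Fin p) → 𝒳 i) → ℝ := fun k x =>
    if marginal P (D k) x = 0 then ((𝒳 k).card : ℝ)⁻¹
    else marginal P (insert k (D k)) x / marginal P (D k) x
  have hupd : ∀ k x a, marginal P (D k) (Function.update x k a) = marginal P (D k) x := by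
    refine fun k x a => marginal_congr P fun i hi => Function.update_of_ne ?_ _ _
    rintro rfl
    exact hkD i hi
  refine ⟨κ, fun k x y hxy => ?_, fun k x => ?_, fun k x => ?_, ?_⟩
  · have h1 : marginal P (insert k (D k)) x = marginal P (insert k (D k)) y :=
      marginal_congr P fun i hi => hxy i ((Finset.mem_insert.1 hi).imp_right (hD k i).1)
    have h2 : marginal P (D k) x = marginal P (D k) y :=
      marginal_congr P fun i hi => hxy i (Or.inr ((hD k i).1 hi))
    simp only [κ, h1, h2]
  · by_cases h : marginal P (D k) x = 0
    · simp [κ, h]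
    · simp only [κ, if_neg h]
      exact div_nonneg (marginal_nonneg hP0 _ _) (marginal_nonneg hP0 _ _)
  · simp only [κ, hupd]
    by_cases h : marginal P (D k) x = 0
    · have hc : ((𝒳 k).card : ℝ) ≠ 0 := by exact_mod_cast (Finset.card_pos.2 (h𝒳 k)).ne'
      simp [h, hc]
    · simp only [if_neg h]
      rw [← Finset.sum_div, sum_marginal_insert_update P (hkD k), div_self h]
  · have hstep : ∀ (k : Fin p) x,
        marginal P (insert k (Finset.Iio k)) x = marginal P (Finset.Iio k) x * κ k x := by
      intro k x
      have hDk : D k ⊆ Finset.Iio k := fun i hi => Finset.mem_Iio.2 ((hD k i).1 hi).2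
      by_cases h : marginal P (D k) x = 0
      · have h1 : marginal P (Finset.Iio k) x = 0 :=
          le_antisymm (h ▸ marginal_anti hP0 hDk x) (marginal_nonneg hP0 _ _)
        have h2 : marginal P (insert k (Finset.Iio k)) x = 0 :=
          le_antisymm (h1 ▸ marginal_anti hP0 (Finset.subset_insert _ _) x)
            (marginal_nonneg hP0 _ _)
        rw [h1, h2, zero_mul]
      · simp only [κ, if_neg h]
        have hsep : Separates G (D k) {k} (Finset.Iio k \ D k) := by
          intro b hb c hc w
          obtain rfl := Finset.mem_singleton.1 hb
          obtain ⟨m, h, hm, hh, hadj, hmem⟩ := exists_crossing w le_rfl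
            (Finset.mem_Iio.1 (Finset.mem_sdiff.1 hc).1)
          refine ⟨h, (hD b h).2 ⟨?_, hh⟩, hmem⟩
          rcases hm.eq_or_lt with rfl | hm
          · exact hadj
          · exact hG h b m hh hm hadj
        have hci := hM (D k) {k} (Finset.Iio k \ D k)
          (Finset.disjoint_singleton_right.2 (hkD k)) Finset.disjoint_sdiff
          (Finset.disjoint_singleton_left.2 (by simp)) hsep x
        have e1 : D k ∪ {k} = insert k (D k) := by ext; simp
        have e2 : D k ∪ (Finset.Iio k \ D k) = Finset.Iio k := Finset.union_sdiff_of_subset hDk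
        have e3 : D k ∪ {k} ∪ (Finset.Iio k \ D k) = insert k (Finset.Iio k) := by
          rw [e1, Finset.insert_union, e2]
        rw [e3, e1, e2] at hci
        rw [mul_div_assoc', eq_div_iff h, hci, mul_comm]
    have key : ∀ n : ℕ, n ≤ p → ∀ x, marginal P (univ.filter fun i : Fin p => (i : ℕ) < n) x =
        ∏ k ∈ univ.filter (fun i : Fin p => (i : ℕ) < n), κ k x := by
      intro n
      induction n with
      | zero =>
        intro _ x
        simp [marginal_empty, hP1]
      | succ n ih =>
        intro hn x
        have e1 : (univ.filter fun i : Fin p => (i : ℕ) < n) = Finset.Iio ⟨n, hn⟩ := by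
          ext i
          simp [Fin.lt_def]
        have e2 : (univ.filter fun i : Fin p => (i : ℕ) < n + 1) =
            insert ⟨n, hn⟩ (Finset.Iio ⟨n, hn⟩) := by
          ext i
          simp only [mem_filter, mem_univ, true_and, mem_insert, mem_Iio, Fin.lt_def, Fin.ext_iff]
          omega
        have := ih (by omega) x
        rw [e1] at this
        rw [e2, hstep, this, Finset.prod_insert (by simp), mul_comm]
    funext x
    have := key p le_rfl x
    simpa [marginal_univ] using this

lemma graphicalModel_eq_sequentialModel (h𝒳 : ∀ i, (𝒳 i).Nonempty) {G : SimpleGraph (Fin p)}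
    (hG : ∀ h j i : Fin p, h < j → j < i → G.Adj i h → G.Adj j h) :
    graphicalModel 𝒳 G = sequentialModel 𝒳 (earlierNeighbors G) :=
  (graphicalModel_subset_sequentialModel h𝒳 hG).antisymm
    (sequentialModel_subset_graphicalModel h𝒳 hG)

end Markov

/-! ### Paths and determinism -/

namespace PFA

variable {Sym : Type u} {A : PFA Sym}

lemma IsPath.append {u v w : A.V} {l m : List A.E} (hl : A.IsPath u l v) (hm : A.IsPath v m w) :
    A.IsPath u (l ++ m) w := by
  induction l generalizing u with
  | nil =>
    obtain rfl : u = v := hl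
    exact hm
  | cons e l ih => exact ⟨hl.1, ih hl.2⟩

lemma isPath_ofFn_iff {n : ℕ} {v w : A.V} {e : Fin n → A.E} :
    A.IsPath v (List.ofFn e) w ↔ ∃ s : Fin (n + 1) → A.V, s 0 = v ∧ s (Fin.last n) = w ∧
      ∀ k, A.src (e k) = s k.castSucc ∧ A.tgt (e k) = s k.succ := by
  induction n generalizing v with
  | zero =>
    rw [List.ofFn_zero]
    constructor
    · intro h
      exact ⟨fun _ => v, rfl, h, fun k => k.elim0⟩
    · rintro ⟨s, hv, hw, -⟩
      exact hv.symm.trans hw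
  | succ n ih =>
    rw [List.ofFn_succ]
    constructor
    · rintro ⟨h0, h⟩
      obtain ⟨s, hs0, hsl, hs⟩ := ih.1 h
      refine ⟨Fin.cons v s, rfl, ?_, fun k => ?_⟩
      · rw [← Fin.succ_last, Fin.cons_succ, hsl]
      · refine Fin.cases ?_ (fun k => ?_) k
        · exact ⟨h0, by rw [Fin.cons_succ, hs0]⟩
        · rw [Fin.castSucc_succ, Fin.cons_succ, Fin.cons_succ]
          exact hs k
    · rintro ⟨s, hs0, hsl, hs⟩
      exact ⟨(hs 0).1.trans hs0, ih.2 ⟨fun k => s k.succ, (hs 0).2.symm, hsl, fun k => hs k.succ⟩⟩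

lemma exists_isPath_from_start {n : ℕ} {e : Fin n → A.E} {s : Fin (n + 1) → A.V}
    (hs : ∀ k, A.src (e k) = s k.castSucc ∧ A.tgt (e k) = s k.succ) (k : Fin (n + 1)) :
    ∃ l, l.length = (k : ℕ) ∧ A.IsPath (s 0) l (s k) := by
  induction k using Fin.induction with
  | zero => exact ⟨[], rfl, rfl⟩
  | succ k ih =>
    obtain ⟨l, hl, h⟩ := ih
    exact ⟨l ++ [e k], by simpa using hl, h.append ⟨(hs k).1, (hs k).2⟩⟩

lemma exists_isPath_to_end {n : ℕ} {e : Fin n → A.E} {s : Fin (n + 1) → A.V}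
    (hs : ∀ k, A.src (e k) = s k.castSucc ∧ A.tgt (e k) = s k.succ) (k : Fin (n + 1)) :
    ∃ l, l.length + (k : ℕ) = n ∧ A.IsPath (s k) l (s (Fin.last n)) := by
  induction k using Fin.reverseInduction with
  | last => exact ⟨[], by simp, rfl⟩
  | cast k ih =>
    obtain ⟨l, hl, h⟩ := ih
    refine ⟨e k :: l, ?_, (hs k).1, (hs k).2 ▸ h⟩
    rw [Fin.val_succ] at hl
    rw [List.length_cons, Fin.val_castSucc]
    omega

variable {p : ℕ}

/-- Edges leaving one state carry distinct symbols, so state and symbol determine the next edge,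
hence the next state. -/
lemma IsRootSinkPath.src_congr {e f : Fin p → A.E} (he : A.IsRootSinkPath e)
    (hf : A.IsRootSinkPath f) {a b : Fin p} (hab : a ≤ b) (ha : A.src (e a) = A.src (f a))
    (h : ∀ k, a ≤ k → k < b → A.sym (e k) = A.sym (f k)) : A.src (e b) = A.src (f b) := by
  obtain ⟨s, -, -, hs⟩ := isPath_ofFn_iff.1 he
  obtain ⟨t, -, -, ht⟩ := isPath_ofFn_iff.1 hf
  obtain ⟨b, hb⟩ := b
  induction b with
  | zero =>
    obtain rfl : a = ⟨0, hb⟩ := Fin.ext (Nat.le_zero.1 (Fin.le_def.1 hab))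
    exact ha
  | succ b ih =>
    rcases hab.eq_or_lt with rfl | hlt
    · exact ha
    have hle : a ≤ ⟨b, by omega⟩ := Fin.le_def.2 (by simpa [Fin.lt_def, Nat.lt_succ_iff] using hlt)
    have hsrc := ih (by omega) hle fun k hk hkb => h k hk (Fin.lt_def.2 (by
      have := Fin.lt_def.1 hkb
      simp only at this ⊢
      omega))
    have heq := A.sym_injective _ _ hsrc (h _ hle (Fin.lt_def.2 (by simp)))
    have h1 := (hs ⟨b, by omega⟩).2
    have h2 := (ht ⟨b, by omega⟩).2
    have h3 := (hs ⟨b + 1, hb⟩).1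
    have h4 := (ht ⟨b + 1, hb⟩).1
    rw [h3, h4]
    rw [heq] at h1
    exact h1.symm.trans h2

lemma IsRootSinkPath.src_zero {e f : Fin p → A.E} (he : A.IsRootSinkPath e)
    (hf : A.IsRootSinkPath f) (h0 : 0 < p) : A.src (e ⟨0, h0⟩) = A.src (f ⟨0, h0⟩) := by
  obtain ⟨s, hs0, -, hs⟩ := isPath_ofFn_iff.1 he
  obtain ⟨t, ht0, -, ht⟩ := isPath_ofFn_iff.1 hf
  exact (((hs ⟨0, h0⟩).1.trans hs0).trans ht0.symm).trans (ht ⟨0, h0⟩).1.symm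

lemma IsRootSinkPath.src_congr_of_past {e f : Fin p → A.E} (he : A.IsRootSinkPath e)
    (hf : A.IsRootSinkPath f) {b : Fin p} (h : ∀ k, k < b → A.sym (e k) = A.sym (f k)) :
    A.src (e b) = A.src (f b) :=
  he.src_congr hf (a := ⟨0, b.pos⟩) (Fin.le_def.2 (Nat.zero_le _)) (he.src_zero hf b.pos)
    fun k _ hk => h k hk

lemma IsRootSinkPath.eq_of_sym_eq {e f : Fin p → A.E} (he : A.IsRootSinkPath e)
    (hf : A.IsRootSinkPath f) (h : ∀ k, A.sym (e k) = A.sym (f k)) : e = f :=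
  funext fun b => A.sym_injective _ _ (he.src_congr_of_past hf fun k _ => h k) (h b)

end PFA

namespace APFA

variable {Sym : Type u} {p : ℕ} {𝒳 : Fin p → Finset Sym}

lemma prob_eq_prod (A : APFA 𝒳) (π : A.E → ℝ) {x : (i : Fin p) → 𝒳 i} {e : Fin p → A.E}
    (he : A.IsRootSinkPath e) (hx : ∀ k, A.sym (e k) = x k) : A.prob π x = ∏ k, π (e k) := by
  classical
  unfold prob
  rw [Finset.sum_eq_single e]
  · intro f hf hfe
    obtain ⟨hf, hfx⟩ := (Finset.mem_filter.1 hf).2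
    exact absurd (hf.eq_of_sym_eq he fun k => (hfx k).trans (hx k).symm) hfe
  · intro h
    exact absurd (Finset.mem_filter.2 ⟨Finset.mem_univ _, he, hx⟩) h

lemma exists_path_of_prob_ne_zero (A : APFA 𝒳) {π : A.E → ℝ} {x : (i : Fin p) → 𝒳 i}
    (h : A.prob π x ≠ 0) :
    ∃ e : Fin p → A.E, A.IsRootSinkPath e ∧ ∀ k, A.sym (e k) = x k := by
  classical
  obtain ⟨e, he, -⟩ := Finset.exists_ne_zero_of_sum_ne_zero h
  exact ⟨e, (Finset.mem_filter.1 he).2⟩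

/-- Following `e` up to the common state and `f` from there to the sink gives a path of length `j +
(p - k)`, which must be `p`. -/
lemma level_unique (A : APFA 𝒳) {e f : Fin p → A.E} (he : A.IsRootSinkPath e)
    (hf : A.IsRootSinkPath f) {j k : Fin p} (h : A.src (e j) = A.src (f k)) : j = k := by
  obtain ⟨s, hs0, -, hs⟩ := PFA.isPath_ofFn_iff.1 he
  obtain ⟨t, -, htl, ht⟩ := PFA.isPath_ofFn_iff.1 hf
  obtain ⟨l, hl, hl'⟩ := PFA.exists_isPath_from_start hs j.castSucc
  obtain ⟨m, hm, hm'⟩ := PFA.exists_isPath_to_end ht k.castSucc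
  rw [hs0, ← (hs j).1, h] at hl'
  rw [htl, ← (ht k).1] at hm'
  have := A.length_eq _ (hl'.append hm')
  rw [List.length_append, hl] at this
  simp only [Fin.val_castSucc] at this hm
  exact Fin.ext (by omega)

end APFA

/-! ### The automaton that remembers selected earlier variables -/

section MemoryAutomaton

variable {Sym : Type u} {p : ℕ} {𝒳 : Fin p → Finset Sym}

/-- Configurations with the elements of the sample spaces replaced by numbers. -/
abbrev Code (𝒳 : Fin p → Finset Sym) : Type := (i : Fin p) → Fin (𝒳 i).card

/-- States and edges of a `PFA` lie in `Type`, whereas `Sym` may live in a higher universe; recoding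
by numbers lets configurations serve as states. -/
noncomputable def code : ((i : Fin p) → 𝒳 i) ≃ Code 𝒳 :=
  Equiv.piCongrRight fun i => (𝒳 i).equivFin

lemma code_apply (x : (i : Fin p) → 𝒳 i) (i : Fin p) : code x i = (𝒳 i).equivFin (x i) := rfl

lemma code_symm_apply (y : Code 𝒳) (i : Fin p) : code.symm y i = (𝒳 i).equivFin.symm (y i) := rfl

open Classical in
/-- Replace the coordinates outside `S` by default values. -/
noncomputable def forget (d : Code 𝒳) (S : Set (Fin p)) (y : Code 𝒳) : Code 𝒳 :=
  fun i => if i ∈ S then y i else d i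

lemma forget_of_mem {d : Code 𝒳} {S : Set (Fin p)} {y : Code 𝒳} {i : Fin p} (hi : i ∈ S) :
    forget d S y i = y i := if_pos hi

lemma forget_of_notMem {d : Code 𝒳} {S : Set (Fin p)} {y : Code 𝒳} {i : Fin p} (hi : i ∉ S) :
    forget d S y i = d i := if_neg hi

lemma forget_eq_iff {d : Code 𝒳} {S : Set (Fin p)} {y z : Code 𝒳} :
    forget d S y = forget d S z ↔ ∀ i ∈ S, y i = z i := by
  constructor
  · intro h i hi
    rw [← forget_of_mem (d := d) (y := y) hi, h, forget_of_mem hi]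
  · intro h
    funext i
    by_cases hi : i ∈ S
    · rw [forget_of_mem hi, forget_of_mem hi, h i hi]
    · rw [forget_of_notMem hi, forget_of_notMem hi]

lemma forget_forget_of_subset {d : Code 𝒳} {S T : Set (Fin p)} (h : S ⊆ T) (y : Code 𝒳) :
    forget d S (forget d T y) = forget d S y :=
  forget_eq_iff.2 fun _ hi => forget_of_mem (h hi)

lemma forget_idem {d : Code 𝒳} {S : Set (Fin p)} (y : Code 𝒳) :
    forget d S (forget d S y) = forget d S y :=
  forget_forget_of_subset subset_rfl y

/-- What is remembered at each level. Nothing is remembered at the last level. -/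
def memoryAt (D : Fin p → Set (Fin p)) (k : Fin (p + 1)) : Set (Fin p) :=
  {i | ∃ h : (k : ℕ) < p, i ∈ D ⟨k, h⟩}

lemma memoryAt_castSucc (D : Fin p → Set (Fin p)) (k : Fin p) : memoryAt D k.castSucc = D k := by
  ext i
  exact ⟨fun ⟨_, h⟩ => h, fun h => ⟨k.2, h⟩⟩

lemma memoryAt_last (D : Fin p → Set (Fin p)) : memoryAt D (Fin.last p) = ∅ := by
  ext i
  exact ⟨fun ⟨h, _⟩ => absurd h (lt_irrefl p), fun h => h.elim⟩

/-- Memory consists of earlier variables, and what has been forgotten is not remembered later. -/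
structure IsMemory (D : Fin p → Set (Fin p)) : Prop where
  lt : ∀ k, D k ⊆ Set.Iio k
  step : ∀ j k : Fin p, (j : ℕ) + 1 = k → D k ⊆ insert j (D j)

namespace IsMemory

variable {D : Fin p → Set (Fin p)}

lemma memoryAt_zero (hD : IsMemory D) : memoryAt D 0 = ∅ := by
  ext i
  exact ⟨fun ⟨_, h⟩ => absurd (Fin.lt_def.1 (hD.lt _ h)) (Nat.not_lt_zero _), fun h => h.elim⟩

lemma memoryAt_succ (hD : IsMemory D) (k : Fin p) : memoryAt D k.succ ⊆ insert k (D k) := by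
  rintro i ⟨h, hi⟩
  exact hD.step k _ rfl hi

end IsMemory

lemma isMemory_memoryAt_castSucc (D : Fin p → Set (Fin p)) (k : Fin p) :
    memoryAt D k.castSucc ⊆ insert k (D k) := by
  rw [memoryAt_castSucc]
  exact Set.subset_insert _ _

variable (D : Fin p → Set (Fin p)) (d : Code 𝒳)

/-- The states: a level and the remembered values. -/
abbrev MemoryState : Type :=
  {v : Fin (p + 1) × Code 𝒳 // forget d (memoryAt D v.1) v.2 = v.2}

/-- The edges: a level, the remembered values, and the value that is generated. -/
abbrev MemoryEdge : Type :=
  {e : Fin p × Code 𝒳 // forget d (insert e.1 (D e.1)) e.2 = e.2}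

/-- Partial configurations are represented by full ones fixed by `forget`. Since arbitrary `y` are
normalized here, one configuration labels a whole path. -/
noncomputable def memoryState (k : Fin (p + 1)) (y : Code 𝒳) : MemoryState D d :=
  ⟨(k, forget d (memoryAt D k) y), forget_idem y⟩

noncomputable def memoryEdge (k : Fin p) (y : Code 𝒳) : MemoryEdge D d :=
  ⟨(k, forget d (insert k (D k)) y), forget_idem y⟩

variable {D d}

lemma memoryState_eq_iff {k : Fin (p + 1)} {y z : Code 𝒳} :
    memoryState D d k y = memoryState D d k z ↔ ∀ i ∈ memoryAt D k, y i = z i := by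
  rw [← forget_eq_iff (d := d)]
  constructor
  · intro h
    exact congrArg (fun v : MemoryState D d => v.1.2) h
  · intro h
    exact Subtype.ext (Prod.ext rfl h)

lemma memoryState_self (v : MemoryState D d) : memoryState D d v.1.1 v.1.2 = v :=
  Subtype.ext (Prod.ext rfl v.2)

lemma memoryEdge_self (e : MemoryEdge D d) : memoryEdge D d e.1.1 e.1.2 = e :=
  Subtype.ext (Prod.ext rfl e.2)

lemma memoryEdge_congr {k : Fin p} {y z : Code 𝒳} (h : ∀ i ∈ insert k (D k), y i = z i) :
    memoryEdge D d k y = memoryEdge D d k z :=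
  Subtype.ext (Prod.ext rfl (forget_eq_iff.2 h))

open Classical in
/-- The labelled graph of `memoryAPFA`. -/
noncomputable def memoryPFA (hp : 0 < p) (hD : IsMemory D) (d : Code 𝒳) : PFA Sym where
  V := MemoryState D d
  E := MemoryEdge D d
  src e := memoryState D d e.1.1.castSucc e.1.2
  tgt e := memoryState D d e.1.1.succ e.1.2
  sym e := (𝒳 e.1.1).equivFin.symm (e.1.2 e.1.1)
  root := memoryState D d 0 d
  sink := memoryState D d (Fin.last p) d
  root_ne_sink h := by
    have := congrArg (fun v : MemoryState D d => (v.1.1 : ℕ)) h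
    exact hp.ne this
  tgt_ne_root e h := by
    have := congrArg (fun v : MemoryState D d => (v.1.1 : ℕ)) h
    exact Nat.succ_ne_zero _ this
  src_ne_sink e h := by
    have := congrArg (fun v : MemoryState D d => (v.1.1 : ℕ)) h
    exact e.1.1.2.ne this
  exists_incoming v hv := by
    rcases Fin.eq_zero_or_eq_succ v.1.1 with h | ⟨k, hk⟩
    · refine absurd ?_ hv
      rw [← memoryState_self v, h, memoryState_eq_iff, hD.memoryAt_zero]
      exact fun i hi => hi.elim
    -- The state remembers no more than an edge of the previous level carries, so its own
    -- configuration supplies an incoming edge.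
    · refine ⟨memoryEdge D d k v.1.2, ?_⟩
      conv_rhs => rw [← memoryState_self v, hk]
      refine memoryState_eq_iff.2 fun i hi => forget_of_mem (hD.memoryAt_succ k hi)
  exists_outgoing v hv := by
    rcases Fin.eq_castSucc_or_eq_last v.1.1 with ⟨k, hk⟩ | h
    · refine ⟨memoryEdge D d k v.1.2, ?_⟩
      conv_rhs => rw [← memoryState_self v, hk]
      refine memoryState_eq_iff.2 fun i hi => forget_of_mem (isMemory_memoryAt_castSucc D k hi)
    · refine absurd ?_ hv
      rw [← memoryState_self v, h, memoryState_eq_iff, memoryAt_last]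
      exact fun i hi => hi.elim
  sym_injective := by
    rintro ⟨⟨k, y⟩, hy⟩ ⟨⟨l, z⟩, hz⟩ hsrc hsym
    obtain rfl : k = l :=
      Fin.castSucc_injective _ (congrArg (fun v : MemoryState D d => v.1.1) hsrc)
    have h1 := memoryState_eq_iff.1 hsrc
    have h2 : y k = z k := (𝒳 k).equivFin.symm.injective (Subtype.ext hsym)
    rw [← memoryEdge_self ⟨(k, y), hy⟩, ← memoryEdge_self ⟨(k, z), hz⟩]
    refine memoryEdge_congr ?_
    rintro i (rfl | hi)
    · exact h2
    · exact h1 i (by rwa [memoryAt_castSucc])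

variable {hp : 0 < p} {hD : IsMemory D}

lemma memoryPFA_path (y : Code 𝒳) (k : Fin p) :
    (memoryPFA hp hD d).src (memoryEdge D d k y) = memoryState D d k.castSucc y ∧
    (memoryPFA hp hD d).tgt (memoryEdge D d k y) = memoryState D d k.succ y :=
  ⟨memoryState_eq_iff.2 fun _ hi => forget_of_mem (isMemory_memoryAt_castSucc D k hi),
    memoryState_eq_iff.2 fun _ hi => forget_of_mem (hD.memoryAt_succ k hi)⟩

lemma memoryState_zero (y : Code 𝒳) : memoryState D d 0 y = (memoryPFA hp hD d).root := by
  refine memoryState_eq_iff.2 ?_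
  rw [hD.memoryAt_zero]
  exact fun i hi => hi.elim

lemma memoryState_last (y : Code 𝒳) :
    memoryState D d (Fin.last p) y = (memoryPFA hp hD d).sink := by
  refine memoryState_eq_iff.2 ?_
  rw [memoryAt_last]
  exact fun i hi => hi.elim

lemma memoryPFA_isRootSinkPath (y : Code 𝒳) :
    (memoryPFA hp hD d).IsRootSinkPath fun k => memoryEdge D d k y :=
  PFA.isPath_ofFn_iff.2 ⟨fun k => memoryState D d k y, memoryState_zero y, memoryState_last y,
    memoryPFA_path y⟩

lemma memoryPFA_sym (y : Code 𝒳) (k : Fin p) :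
    (memoryPFA hp hD d).sym (memoryEdge D d k y) = code.symm y k := by
  change (((𝒳 k).equivFin.symm (forget d (insert k (D k)) y k) : 𝒳 k) : Sym) = _
  rw [forget_of_mem (Set.mem_insert _ _), code_symm_apply]

lemma memoryPFA_level {v w : (memoryPFA hp hD d).V} {l : List (memoryPFA hp hD d).E}
    (h : (memoryPFA hp hD d).IsPath v l w) :
    (w.1.1 : ℕ) = (v.1.1 : ℕ) + l.length := by
  induction l generalizing v with
  | nil =>
    obtain rfl : v = w := h
    rfl
  | cons e l ih =>
    rw [ih h.2, ← h.1, List.length_cons]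
    change ((e.1.1 : ℕ) + 1) + l.length = (e.1.1 : ℕ) + (l.length + 1)
    omega

variable (d hp hD) in
/-- The automaton that remembers the values of the variables in `D k` at level `k`. -/
noncomputable def memoryAPFA : APFA 𝒳 where
  toPFA := memoryPFA hp hD d
  path_from_root := fun (v : MemoryState D d) => by
    obtain ⟨l, -, hl⟩ := PFA.exists_isPath_from_start (A := memoryPFA hp hD d)
      (s := fun k => memoryState D d k v.1.2) (memoryPFA_path v.1.2) v.1.1
    rw [memoryState_self, memoryState_zero (hp := hp) (hD := hD)] at hl
    exact ⟨l, hl⟩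
  path_to_sink := fun (v : MemoryState D d) => by
    obtain ⟨l, -, hl⟩ := PFA.exists_isPath_to_end (A := memoryPFA hp hD d)
      (s := fun k => memoryState D d k v.1.2) (memoryPFA_path v.1.2) v.1.1
    rw [memoryState_self, memoryState_last (hp := hp) (hD := hD)] at hl
    exact ⟨l, hl⟩
  length_eq l hl := by
    have h := memoryPFA_level hl
    change p = 0 + l.length at h
    omega
  mem_sampleSpace k a := by
    constructor
    · intro ha
      let y : Code 𝒳 := Function.update d k ((𝒳 k).equivFin ⟨a, ha⟩)
      refine ⟨fun k => memoryEdge D d k y, memoryPFA_isRootSinkPath y, ?_⟩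
      rw [memoryPFA_sym, code_symm_apply]
      simp [y]
    · rintro ⟨e, he, rfl⟩
      obtain ⟨s, hs0, -, hs⟩ := PFA.isPath_ofFn_iff.1 he
      obtain ⟨l, hl, hl'⟩ := PFA.exists_isPath_from_start hs k.castSucc
      have h := memoryPFA_level hl'
      rw [hs0, ← (hs k).1, hl] at h
      have hk : (e k).1.1 = k := by
        refine Fin.ext (h.trans ?_)
        exact Nat.zero_add _
      have hmem : (memoryPFA hp hD d).sym (e k) ∈ 𝒳 (e k).1.1 :=
        ((𝒳 (e k).1.1).equivFin.symm ((e k).1.2 (e k).1.1)).2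
      rwa [hk] at hmem

lemma memoryAPFA_prob (π : (memoryAPFA d hp hD).E → ℝ) (x : (i : Fin p) → 𝒳 i) :
    (memoryAPFA d hp hD).prob π x = ∏ k, π (memoryEdge D d k (code x)) :=
  APFA.prob_eq_prod _ π (memoryPFA_isRootSinkPath (hp := hp) (hD := hD) (code x)) fun k => by
    change (memoryPFA hp hD d).sym _ = _
    rw [memoryPFA_sym, Equiv.symm_apply_apply]

-- The memory lies strictly before `k`, so changing the `k`-th value keeps the state and runs
-- through its outgoing edges. Normalization of edge probabilities thus becomes normalization of
-- kernels.
open Classical in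
lemma memoryAPFA_sum_edges (π : (memoryAPFA d hp hD).E → ℝ) (k : Fin p) (x : (i : Fin p) → 𝒳 i) :
    ∑ e with (memoryAPFA d hp hD).src e = memoryState D d k.castSucc (code x), π e =
      ∑ a, π (memoryEdge D d k (code (Function.update x k a))) := by
  symm
  refine Finset.sum_bij (fun a _ => memoryEdge D d k (code (Function.update x k a)))
    (fun a _ => ?_) (fun a _ b _ hab => ?_) (fun e he => ?_) (fun _ _ => rfl)
  · refine Finset.mem_filter.2 ⟨Finset.mem_univ _, (memoryPFA_path (hp := hp) (hD := hD) _ k).1.trans ?_⟩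
    refine memoryState_eq_iff.2 fun i hi => ?_
    rw [memoryAt_castSucc] at hi
    rw [code_apply, code_apply, Function.update_of_ne (hD.lt k hi).ne]
  · have h := congrArg (memoryPFA hp hD d).sym hab
    rw [memoryPFA_sym, memoryPFA_sym, Equiv.symm_apply_apply, Equiv.symm_apply_apply,
      Function.update_self, Function.update_self] at h
    exact Subtype.ext h
  · obtain ⟨⟨l, y⟩, hy⟩ := e
    have hsrc := (Finset.mem_filter.1 he).2
    obtain rfl : l = k :=
      Fin.castSucc_injective _ (congrArg (fun v : MemoryState D d => v.1.1) hsrc)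
    have h := memoryState_eq_iff.1 hsrc
    refine ⟨code.symm y l, Finset.mem_univ _, ?_⟩
    conv_rhs => rw [← memoryEdge_self ⟨(l, y), hy⟩]
    refine memoryEdge_congr ?_
    rintro i (rfl | hi)
    · rw [code_apply, Function.update_self, code_symm_apply, Equiv.apply_symm_apply]
    · rw [code_apply, Function.update_of_ne (hD.lt l hi).ne, ← code_apply]
      exact (h i (by rwa [memoryAt_castSucc])).symm

/-- An edge of level `k` is a value of `X_k` together with the values on `D k`: edge probabilities
and kernels are the same data. -/
lemma memoryAPFA_model : (memoryAPFA d hp hD).model = sequentialModel 𝒳 D := by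
  classical
  ext P
  constructor
  · rintro ⟨π, ⟨hπ0, hπ1⟩, rfl⟩
    refine ⟨fun k x => π (memoryEdge D d k (code x)), fun k x y hxy => ?_, fun k x => hπ0 _,
      fun k x => ?_, funext (memoryAPFA_prob π)⟩
    · exact congrArg π (memoryEdge_congr fun i hi => by rw [code_apply, code_apply, hxy i hi])
    · rw [← memoryAPFA_sum_edges]
      refine (Finset.sum_congr (Finset.filter_congr fun _ _ => Iff.rfl) fun _ _ => rfl).trans
        (hπ1 _ ?_)
      rw [← (memoryPFA_path (hp := hp) (hD := hD) (code x) k).1]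
      exact (memoryAPFA d hp hD).src_ne_sink _
  · rintro ⟨κ, hdep, hκ0, hκ1, rfl⟩
    -- The default values stored in an edge are invisible to the kernel.
    have hκ : ∀ k x, κ k (code.symm (memoryEdge D d k (code x)).1.2) = κ k x := fun k x => by
      refine hdep k fun i hi => ?_
      rw [code_symm_apply]
      change (𝒳 i).equivFin.symm (forget d (insert k (D k)) (code x) i) = x i
      rw [forget_of_mem hi, code_apply, Equiv.symm_apply_apply]
    refine ⟨fun e => κ e.1.1 (code.symm e.1.2), ⟨fun e => hκ0 _ _, fun v hv => ?_⟩, ?_⟩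
    · rcases Fin.eq_castSucc_or_eq_last v.1.1 with ⟨k, hk⟩ | h
      · have hv' : v = memoryState D d k.castSucc (code (code.symm v.1.2)) := by
          rw [Equiv.apply_symm_apply, ← hk]
          exact (memoryState_self v).symm
        rw [← hκ1 k (code.symm v.1.2)]
        refine (Finset.sum_congr (Finset.filter_congr fun e _ => by rw [← hv']) fun _ _ => rfl).trans
          ((memoryAPFA_sum_edges (hp := hp) (hD := hD) (d := d) _ k (code.symm v.1.2)).trans
            (Finset.sum_congr rfl fun a _ => hκ k _))
      · refine absurd ?_ hv
        rw [← memoryState_self v, h]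
        exact memoryState_last (hp := hp) (hD := hD) _
    · funext x
      rw [memoryAPFA_prob]
      exact Finset.prod_congr rfl fun k _ => (hκ k x).symm

end MemoryAutomaton

/-! ### Necessity: what an automaton must remember -/

section Necessity

variable {Sym : Type u} {p : ℕ} {𝒳 : Fin p → Finset Sym}

lemma div_sum_mem_graphicalModel (h𝒳 : ∀ i, (𝒳 i).Nonempty) {G : SimpleGraph (Fin p)}
    {f : ((i : Fin p) → 𝒳 i) → ℝ} (hf : ∀ x, 0 < f x) {c : Set (Fin p)} (hdep : DependsOn f c)
    (hc : G.IsClique c) : (fun x => f x / ∑ y, f y) ∈ graphicalModel 𝒳 G := by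
  have hne : Nonempty ((i : Fin p) → 𝒳 i) := ⟨fun i => ⟨_, (h𝒳 i).choose_spec⟩⟩
  have hpos : 0 < ∑ y, f y := Finset.sum_pos (fun y _ => hf y) Finset.univ_nonempty
  refine ⟨⟨fun x => (div_pos (hf x) hpos).le, ?_⟩, ?_⟩
  · rw [← Finset.sum_div, div_self hpos.ne']
  · intro A B C hAB hAC _ hsep
    have h := condIndependent_of_prod (ι := Unit) (φ := fun _ x => f x / ∑ y, f y) (c := fun _ => c)
      (fun _ x y hxy => by simp only [hdep hxy]) (fun _ => hc) hAB hAC hsep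
    simpa using h

/-- In the graphical model, the coordinates of two non-adjacent nodes cannot force each other. -/
lemma pos_of_mem_graphicalModel {G : SimpleGraph (Fin p)} {P : ((i : Fin p) → 𝒳 i) → ℝ}
    (hP : P ∈ graphicalModel 𝒳 G) {h j : Fin p} (hne : h ≠ j) (hadj : ¬ G.Adj j h)
    {x y z : (i : Fin p) → 𝒳 i} (hxy : ∀ k, k ≠ j → x k = y k) (hxz : ∀ k, k ≠ h → x k = z k)
    (hy : 0 < P y) (hz : 0 < P z) : 0 < P x := by
  classical
  have hP0 := hP.1.1
  -- Pairwise Markov property: all other nodes separate `h` from `j`. The two marginals on the right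
  -- of the resulting identity at `x` dominate `P y` and `P z`, so `P x` cannot vanish.
  let R : Finset (Fin p) := (univ.erase h).erase j
  have hsep : Separates G R {h} {j} := by
    intro b hb c hc w
    obtain rfl := Finset.mem_singleton.1 hb
    obtain rfl := Finset.mem_singleton.1 hc
    cases w with
    | nil => exact absurd rfl hne
    | @cons _ v _ hv w =>
      refine ⟨v, ?_, by simp⟩
      simp only [R, Finset.mem_erase, Finset.mem_univ, and_true]
      refine ⟨?_, hv.ne'⟩
      rintro rfl
      exact hadj hv.symm
  have hci := hP.2 R {h} {j} (by simp [R]) (by simp [R]) (by simpa using hne) hsep x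
  have huniv : R ∪ {h} ∪ {j} = univ := by
    ext k
    simp only [R, mem_union, mem_erase, mem_univ, and_true, mem_singleton, iff_true]
    tauto
  rw [huniv, marginal_univ] at hci
  have h1 : 0 < marginal P (R ∪ {h}) x := by
    refine hy.trans_le (le_marginal hP0 fun k hk => (hxy k ?_).symm)
    rintro rfl
    simp [R, hne.symm] at hk
  have h2 : 0 < marginal P (R ∪ {j}) x := by
    refine hz.trans_le (le_marginal hP0 fun k hk => (hxz k ?_).symm)
    rintro rfl
    simp [R, hne] at hk
  refine lt_of_le_of_ne (hP0 x) fun h0 => ?_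
  rw [← h0, zero_mul] at hci
  exact (mul_pos h1 h2).ne hci

namespace APFA

variable (A : APFA 𝒳)

/-- If two pairs of configurations with the same past run through the same state at level `j`, and
have equal futures crosswise, then the odds ratio of their probabilities is one. -/
lemma prob_mul_prob_eq {e : ((i : Fin p) → 𝒳 i) → Fin p → A.E}
    (he : ∀ x, A.IsRootSinkPath (e x)) (hx : ∀ x k, A.sym (e x k) = x k) (π : A.E → ℝ) {j : Fin p}
    {x x' y y' : (i : Fin p) → 𝒳 i} (hxx' : ∀ k < j, x k = x' k) (hyy' : ∀ k < j, y k = y' k)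
    (hxy : ∀ k, j ≤ k → x k = y k) (hxy' : ∀ k, j ≤ k → x' k = y' k)
    (h : A.src (e x j) = A.src (e y j)) :
    A.prob π x * A.prob π y' = A.prob π x' * A.prob π y := by
  have hpast : ∀ u v : (i : Fin p) → 𝒳 i, ∀ b ≤ j, (∀ k < j, u k = v k) →
      A.src (e u b) = A.src (e v b) := fun u v b hb huv =>
    (he u).src_congr_of_past (he v) fun k hk => by rw [hx, hx, huv k (hk.trans_le hb)]
  have hpast' : ∀ u v : (i : Fin p) → 𝒳 i, ∀ b < j, (∀ k < j, u k = v k) → e u b = e v b :=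
    fun u v b hb huv => A.sym_injective _ _ (hpast u v b hb.le huv) (by rw [hx, hx, huv b hb])
  have hfut : ∀ u v : (i : Fin p) → 𝒳 i, ∀ b, j ≤ b → A.src (e u j) = A.src (e v j) →
      (∀ k, j ≤ k → u k = v k) → e u b = e v b := fun u v b hb h0 huv =>
    A.sym_injective _ _ ((he u).src_congr (he v) hb h0 fun k hk _ => by rw [hx, hx, huv k hk])
      (by rw [hx, hx, huv b hb])
  have h' : A.src (e x' j) = A.src (e y' j) := by
    rw [← hpast x x' j le_rfl hxx', h, hpast y y' j le_rfl hyy']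
  rw [A.prob_eq_prod π (he x) (hx x), A.prob_eq_prod π (he y) (hx y),
    A.prob_eq_prod π (he x') (hx x'), A.prob_eq_prod π (he y') (hx y'),
    ← Finset.prod_mul_distrib, ← Finset.prod_mul_distrib]
  refine Finset.prod_congr rfl fun k _ => ?_
  -- Before level `j` the edges of `x`, `x'` and of `y`, `y'` coincide; from `j` on, those of `x`,
  -- `y` and of `x'`, `y'` do.
  rcases lt_or_ge k j with hk | hk
  · rw [hpast' x x' k hk hxx', hpast' y y' k hk hyy']
  · rw [hfut x y k hk h hxy, hfut x' y' k hk h' hxy', mul_comm]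

open Classical in
/-- Uniform edge probabilities, except that the states in `S` emit `b` with certainty. -/
noncomputable def forcingParam (S : Set A.V) (b : Sym) (e : A.E) : ℝ :=
  if A.src e ∈ S then if A.sym e = b then 1 else 0
  else ((univ.filter fun f => A.src f = A.src e).card : ℝ)⁻¹

variable {A}

lemma forcingParam_nonneg (S : Set A.V) (b : Sym) (e : A.E) : 0 ≤ A.forcingParam S b e := by
  unfold forcingParam
  split_ifs
  · exact zero_le_one
  · exact le_rfl
  · positivity

lemma forcingParam_pos {S : Set A.V} {b : Sym} {e : A.E} (h : A.src e ∈ S → A.sym e = b) :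
    0 < A.forcingParam S b e := by
  classical
  unfold forcingParam
  split_ifs with h1 h2
  · exact zero_lt_one
  · exact absurd (h h1) h2
  · exact inv_pos.2 (Nat.cast_pos.2 (Finset.card_pos.2 ⟨e, by simp⟩))

lemma forcingParam_mem_paramSpace {S : Set A.V} {b : Sym}
    (h : ∀ v ∈ S, ∃ e, A.src e = v ∧ A.sym e = b) : A.forcingParam S b ∈ A.paramSpace := by
  classical
  refine ⟨forcingParam_nonneg S b, fun v hv => ?_⟩
  by_cases hS : v ∈ S
  · obtain ⟨e, rfl, he⟩ := h v hS
    rw [Finset.sum_eq_single e]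
    · simp [forcingParam, hS, he]
    · intro f hf hfe
      have hsrc := (Finset.mem_filter.1 hf).2
      have hsym : A.sym f ≠ b := fun hfb => hfe (A.sym_injective f e hsrc (hfb.trans he.symm))
      simp [forcingParam, hsrc, hS, hsym]
    · simp
  · obtain ⟨e, he⟩ := A.exists_outgoing v hv
    have hc : ((univ.filter fun f => A.src f = v).card : ℝ) ≠ 0 := by
      exact_mod_cast (Finset.card_pos.2 ⟨e, by simpa using he⟩).ne'
    rw [Finset.sum_congr rfl (g := fun _ => ((univ.filter fun f => A.src f = v).card : ℝ)⁻¹)]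
    · rw [Finset.sum_const, nsmul_eq_mul, mul_inv_cancel₀ hc]
    · intro f hf
      have hsrc := (Finset.mem_filter.1 hf).2
      simp [forcingParam, hsrc, hS]

/-- Adjacency to an earlier node is inherited by the nodes in between. -/
lemma adj_of_model_eq (h𝒳 : ∀ i, 2 ≤ (𝒳 i).card) {G : SimpleGraph (Fin p)}
    (hA : A.model = graphicalModel 𝒳 G) {h j i : Fin p} (hhj : h < j) (hji : j < i)
    (hadj : G.Adj i h) : G.Adj j h := by
  classical
  by_contra hnadj
  have hex : ∀ k, ∃ q : 𝒳 k × 𝒳 k, q.1 ≠ q.2 := fun k => by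
    obtain ⟨a, ha, b, hb, hab⟩ := Finset.one_lt_card.1 (h𝒳 k)
    exact ⟨(⟨a, ha⟩, ⟨b, hb⟩), fun h => hab (congrArg Subtype.val h)⟩
  choose q hq using hex
  have hne𝒳 : ∀ k, (𝒳 k).Nonempty := fun k => ⟨_, (q k).1.2⟩
  -- A density with odds ratio 2 between `X_h` and `X_i`. Its positivity also gives every
  -- configuration a path in the automaton.
  let f : ((k : Fin p) → 𝒳 k) → ℝ := fun x => if x h = (q h).1 ∧ x i = (q i).1 then 2 else 1
  have hf : ∀ x, 0 < f x := fun x => by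
    simp only [f]
    split_ifs <;> norm_num
  have hfdep : DependsOn f {h, i} := fun x y hxy => by
    simp only [f, hxy h (by simp), hxy i (by simp)]
  have hclique : G.IsClique {h, i} := by
    rw [SimpleGraph.isClique_pair]
    exact fun _ => hadj.symm
  have hpos : 0 < ∑ y, f y :=
    Finset.sum_pos (fun y _ => hf y) ⟨fun k => (q k).1, Finset.mem_univ _⟩
  have hmem := div_sum_mem_graphicalModel hne𝒳 hf hfdep hclique
  rw [← hA] at hmem
  obtain ⟨π, -, hπ⟩ := hmem
  have hprob : ∀ x, A.prob π x = f x / ∑ y, f y := fun x => (congrFun hπ x).symm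
  have hpath : ∀ x : (k : Fin p) → 𝒳 k, ∃ e : Fin p → A.E, A.IsRootSinkPath e ∧ ∀ k, A.sym (e k) = x k := fun x =>
    A.exists_path_of_prob_ne_zero (π := π) (by rw [hprob]; exact (div_pos (hf x) hpos).ne')
  choose e he hsym using hpath
  have hcongr : ∀ x y : (k : Fin p) → 𝒳 k, ∀ b, (∀ k < b, x k = y k) →
      A.src (e x b) = A.src (e y b) := fun x y b hxy =>
    (he x).src_congr_of_past (he y) fun k hk => by rw [hsym, hsym, hxy k hk]
  -- States at level `j` know whether `X_h` has the chosen value: otherwise two pasts differing in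
  -- this would merge, and the odds ratio would be 1.
  have hremember : ∀ x y, A.src (e x j) = A.src (e y j) → x h = (q h).1 → y h = (q h).1 := by
    intro x y hxy hx
    by_contra hy
    -- The past of `z` followed by the future of the fixed `x`, with `X_i` set to `a`.
    let tail : 𝒳 i → ((k : Fin p) → 𝒳 k) → (k : Fin p) → 𝒳 k := fun a z k =>
      if k < j then z k else Function.update x i a k
    have hpast : ∀ a z, ∀ k < j, tail a z k = z k := fun a z k hk => if_pos hk
    have hfut : ∀ a z, ∀ k, j ≤ k → tail a z k = Function.update x i a k :=
      fun a z k hk => if_neg (not_lt.2 hk)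
    have hi : ∀ a z, tail a z i = a := fun a z => by
      rw [hfut a z i hji.le, Function.update_self]
    have hh : ∀ a z, tail a z h = z h := fun a z => hpast a z h hhj
    have key := A.prob_mul_prob_eq he hsym π (j := j) (x := tail (q i).1 x) (x' := tail (q i).2 x)
      (y := tail (q i).1 y) (y' := tail (q i).2 y)
      (fun k hk => by rw [hpast _ _ k hk, hpast _ _ k hk])
      (fun k hk => by rw [hpast _ _ k hk, hpast _ _ k hk])
      (fun k hk => by rw [hfut _ _ k hk, hfut _ _ k hk])
      (fun k hk => by rw [hfut _ _ k hk, hfut _ _ k hk])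
      (by rw [hcongr _ _ j (hpast _ x), hcongr _ _ j (hpast _ y), hxy])
    have f1 : f (tail (q i).1 x) = 2 := by simp [f, hi, hh, hx]
    have f2 : f (tail (q i).2 x) = 1 := by simp [f, hi, hh, (hq i).symm]
    have f3 : f (tail (q i).1 y) = 1 := by simp [f, hh, hy]
    have f4 : f (tail (q i).2 y) = 1 := by simp [f, hh, hy]
    rw [hprob, hprob, hprob, hprob, f1, f2, f3, f4, div_mul_div_comm, div_mul_div_comm] at key
    have := (div_left_inj' (mul_pos hpos hpos).ne').1 key
    norm_num at this
  -- Forcing these states to emit a fixed symbol produces a member of the model in which one value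
  -- of `X_h` determines `X_j`.
  let S : Set A.V := {v | ∃ x, x h = (q h).1 ∧ A.src (e x j) = v}
  have hS : A.forcingParam S (q j).1 ∈ A.paramSpace := by
    refine forcingParam_mem_paramSpace ?_
    rintro _ ⟨x, hx, rfl⟩
    refine ⟨e (Function.update x j (q j).1) j, hcongr _ _ j fun k hk => ?_, ?_⟩
    · rw [Function.update_of_ne hk.ne]
    · rw [hsym, Function.update_self]
  have hP : A.prob (A.forcingParam S (q j).1) ∈ graphicalModel 𝒳 G := by
    rw [← hA]
    exact ⟨_, hS, rfl⟩
  have hP0 : ∀ x : (k : Fin p) → 𝒳 k, (x h = (q h).1 → x j = (q j).1) →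
      0 < A.prob (A.forcingParam S (q j).1) x := by
    intro x hx
    rw [A.prob_eq_prod _ (he x) (hsym x)]
    refine Finset.prod_pos fun k _ => forcingParam_pos ?_
    rintro ⟨y, hy, hyx⟩
    -- States of `S` occur at level `j` only, so the forcing affects no other coordinate.
    obtain rfl : j = k := A.level_unique (he y) (he x) hyx
    rw [hsym, hx (hremember y x hyx hy)]
  let x : (k : Fin p) → 𝒳 k := Function.update (fun k => (q k).1) j (q j).2
  have hxh : x h = (q h).1 := Function.update_of_ne hhj.ne _ _
  have hxj : x j = (q j).2 := Function.update_self ..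
  have hx0 : A.prob (A.forcingParam S (q j).1) x = 0 := by
    rw [A.prob_eq_prod _ (he x) (hsym x)]
    refine Finset.prod_eq_zero (Finset.mem_univ j) ?_
    have h1 : A.src (e x j) ∈ S := ⟨x, hxh, rfl⟩
    have h2 : A.sym (e x j) ≠ (q j).1 := by
      rw [hsym, hxj]
      exact fun h => hq j (Subtype.ext h.symm)
    simp [forcingParam, h1, h2]
  -- The forbidden configuration `x` becomes possible after changing either its `j`-th or its `h`-th
  -- coordinate, so non-adjacency would make `x` itself possible.
  refine (pos_of_mem_graphicalModel hP hhj.ne hnadj (x := x) (y := Function.update x j (q j).1)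
    (z := Function.update x h (q h).2) (fun k hk => (Function.update_of_ne hk _ _).symm)
    (fun k hk => (Function.update_of_ne hk _ _).symm) (hP0 _ fun _ => Function.update_self ..)
    (hP0 _ fun h1 => ?_)).ne' hx0
  rw [Function.update_self] at h1
  exact absurd h1.symm (hq h)

end APFA

end Necessity

/-! ### From consecutive nodes to all nodes in between -/

lemma isMemory_earlierNeighbors {p : ℕ} {G : SimpleGraph (Fin p)}
    (hG : ∀ i j : Fin p, (j : ℕ) + 1 = (i : ℕ) →
      G.neighborSet i ∩ Set.Iio i ⊆ (G.neighborSet j ∩ Set.Iio j) ∪ {j}) :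
    IsMemory (earlierNeighbors G) where
  lt _ _ hi := hi.2
  step j k hjk _ hi := (hG k j hjk hi).symm

/-- A node is adjacent to everything remembered from before it by a later node. -/
lemma IsMemory.adj_of_adj {p : ℕ} {G : SimpleGraph (Fin p)} (hG : IsMemory (earlierNeighbors G))
    {h j i : Fin p} (hhj : h < j) (hji : j < i) (hadj : G.Adj i h) : G.Adj j h := by
  obtain ⟨i, hi⟩ := i
  induction i with
  | zero => exact absurd (Fin.lt_def.1 hji) (Nat.not_lt_zero _)
  | succ n ih =>
    have hjn : (j : ℕ) ≤ n := Nat.lt_succ_iff.1 (Fin.lt_def.1 hji)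
    have hhn : (h : ℕ) < n := (Fin.lt_def.1 hhj).trans_le hjn
    -- Adjacency to `h` descends from `n + 1` to `n`, since `h` is not `n` itself; repeating this
    -- reaches `j`.
    have hn : G.Adj ⟨n, by omega⟩ h := by
      rcases hG.step ⟨n, by omega⟩ ⟨n + 1, hi⟩ rfl ⟨hadj, hhj.trans hji⟩ with h1 | h1
      · exact absurd (congrArg Fin.val h1) hhn.ne
      · exact h1.1
    rcases hjn.eq_or_lt with h1 | h1
    · rwa [show j = ⟨n, by omega⟩ from Fin.ext h1]
    · exact ih _ (Fin.lt_def.2 h1) hn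

theorem theorem3 {Sym : Type u} {p : ℕ} (hp : 1 ≤ p) (𝒳 : Fin p → Finset Sym)
    (h𝒳 : ∀ i, 2 ≤ (𝒳 i).card) (G : SimpleGraph (Fin p)) :
    (∃ A : APFA 𝒳, A.model = graphicalModel 𝒳 G) ↔
      ∀ i j : Fin p, (j : ℕ) + 1 = (i : ℕ) →
        G.neighborSet i ∩ Set.Iio i ⊆ (G.neighborSet j ∩ Set.Iio j) ∪ {j} := by
  constructor
  · rintro ⟨A, hA⟩ i j hji h ⟨hadj, hhi⟩
    have hhj : h ≤ j := Fin.le_def.2 (by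
      have := Fin.lt_def.1 hhi
      omega)
    rcases hhj.eq_or_lt with rfl | hhj
    · exact Or.inr rfl
    · exact Or.inl ⟨APFA.adj_of_model_eq h𝒳 hA hhj (Fin.lt_def.2 (by omega)) hadj, hhj⟩
  · intro hG
    have hD := isMemory_earlierNeighbors hG
    have hcard : ∀ i, 0 < (𝒳 i).card := fun i => two_pos.trans_le (h𝒳 i)
    refine ⟨memoryAPFA (fun i => ⟨0, hcard i⟩) hp hD, ?_⟩
    rw [memoryAPFA_model, graphicalModel_eq_sequentialModel (fun i => Finset.card_pos.1 (hcard i))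
      fun h j i hhj hji hadj => hD.adj_of_adj hhj hji hadj]
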